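/- Let $F$ be an imaginary quadratic field with ring of integers $\mathcal{O}_F$, and fix an embedding $F \hookrightarrow \mathbb{C}$, so that $\mathcal{O}_F^2 \subset \mathbb{C}^2$. For a positive definite $2 \times 2$ complex Hermitian matrix $A$ put $A[x] = \bar{x}^t A x$ for $x \in \mathbb{C}^2$ and $\min(A) = \inf\{A[v] : v \in \mathcal{O}_F^2 \setminus \{0\}\}$. A vector $v \in \mathcal{O}_F^2$ is a minimal vector of $A$ if $A[v] = \min(A)$. Call $A$ perfect over $F$ if the matrices $v\bar{v}^t$, for $v$ a minimal vector of $A$, span the real vector space of all $2 \times 2$ complex Hermitian matrices. Theorem 4.1. For every imaginary quadratic field $F$, every embedding $F \hookrightarrow \mathbb{C}$ and every positive definite $2 \times 2$ complex Hermitian matrix $A$ (in particular, every such $A$ with entries in $F$), the form $A$ has at most $12$ minimal vectors in $\mathcal{O}_F^2$, where $v$ and $-v$ are counted as one. The bound is sharp: there are an imaginary quadratic field $F$, an embedding $F \hookrightarrow \mathbb{C}$ and a positive definite Hermitian form $A$ with entries in $F$ that is perfect over $F$ and has exactly $12$ minimal vectors, where again $v$ and $-v$ are counted as one. -/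

import Mathlib

open scoped ComplexOrder

namespace BinaryHermitian

/-- An imaginary quadratic field: a number field of degree `2` over `ℚ` with no real embedding. -/
def IsImaginaryQuadratic (F : Type*) [Field F] [NumberField F] : Prop :=
  Module.finrank ℚ F = 2 ∧ NumberField.IsTotallyComplex F

/-- The value `A[x] = x̄ᵗ A x` of the Hermitian form of a Hermitian matrix `A` at `x ∈ ℂ²`.
(For Hermitian `A` the complex number `x̄ᵗ A x` is real.) -/
noncomputable def value (A : Matrix (Fin 2) (Fin 2) ℂ) (x : Fin 2 → ℂ) : ℝ :=
  (star x ⬝ᵥ A.mulVec x).re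

section

variable {F : Type*} [Field F] [NumberField F]

/-- The inclusion of `𝓞_F²` in `ℂ²` given by a complex embedding of `F`. -/
def embed (φ : F →+* ℂ) (v : Fin 2 → NumberField.RingOfIntegers F) : Fin 2 → ℂ :=
  fun i => φ (v i : F)

/-- The minimum of `A`: the infimum of `A[v]` over the nonzero `v ∈ 𝓞_F²`. -/
noncomputable def minimum (φ : F →+* ℂ) (A : Matrix (Fin 2) (Fin 2) ℂ) : ℝ :=
  sInf ((fun v => value A (embed φ v)) '' {v | v ≠ 0})

/-- All minimal vectors of `A` in `𝓞_F²`, with both signs. -/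
def minVectors (φ : F →+* ℂ) (A : Matrix (Fin 2) (Fin 2) ℂ) :
    Set (Fin 2 → NumberField.RingOfIntegers F) :=
  {v | value A (embed φ v) = minimum φ A}

/-- The pairs `{v, -v}` of minimal vectors of `A`, that is, the minimal vectors up to sign. -/
def minPairs (φ : F →+* ℂ) (A : Matrix (Fin 2) (Fin 2) ℂ) :
    Set (Set (Fin 2 → NumberField.RingOfIntegers F)) :=
  (fun v => {v, -v}) '' minVectors φ A

/-- The rank one Hermitian matrix `q(v) = v v̄ᵗ`. -/
def q (φ : F →+* ℂ) (v : Fin 2 → NumberField.RingOfIntegers F) : Matrix (Fin 2) (Fin 2) ℂ :=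
  Matrix.vecMulVec (embed φ v) (star (embed φ v))

/-- A positive definite Hermitian form `A` is perfect over `F` if the matrices `q(v)`, for `v` a
minimal vector of `A`, span the real vector space of all `2 × 2` complex Hermitian matrices. -/
def IsPerfect (φ : F →+* ℂ) (A : Matrix (Fin 2) (Fin 2) ℂ) : Prop :=
  A.PosDef ∧
    Submodule.span ℝ (q φ '' minVectors φ A) =
      selfAdjoint.submodule ℝ (Matrix (Fin 2) (Fin 2) ℂ)

end

end BinaryHermitian

/-!
The ring of integers of an imaginary quadratic field has rank two over `ℤ`, so `𝓞_F²` is a lattice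
`L` of rank four on which `v ↦ A[v]` is a positive function `N` satisfying the parallelogram law.
The upper bound is therefore the fact that a lattice of rank four has at most `24` minimal vectors,
which is proved by looking at the classes of minimal vectors in `L / 2L`, a group of order `16`.

Let `m` be the minimum. Minimal vectors `v ≠ ±w` are not congruent modulo `2L`, since `(v + w) / 2`
and `(v - w) / 2` have values adding up to `m` (`eq_or_eq_neg_of_sub_eq_add_self`); nor is a minimal
vector in `2L`. So pairs of minimal vectors correspond to nonzero classes, of which there are `15`.
If more than `12` of these occur, at most two are missing, and there is a three-dimensional subspace
over the field with two elements all of whose seven nonzero classes occur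
(`exists_subspace_of_card_compl_le`). This is impossible (`not_forall_minimal`): whenever the
classes of `a`, `b` and `a + b` occur, one of `a ± b` is minimal (`map_add_eq_or_map_sub_eq`), and
for `a`, `b`, `c` spanning the subspace these conditions conflict at the class of `a + b + c`.

The bound is attained over `ℚ(i)` by the form `|(1 - i) x + y|² + |y|²`, a version of the root
lattice `D₄`. A nonzero algebraic integer of an imaginary quadratic field has absolute value at
least one (`one_le_normSq`), which gives minimum `2`; twelve pairs of minimal vectors are written
down explicitly, and four of them already span the Hermitian matrices.
-/

namespace BinaryHermitian

/-! ### Minimal vectors modulo two under the parallelogram law -/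

section ParallelogramLaw

variable {L : Type*} [AddCommGroup L] {N : L → ℝ}

lemma map_zero_of_parallelogram (hN : ∀ x y, N (x + y) + N (x - y) = 2 * N x + 2 * N y) :
    N 0 = 0 := by
  have h := hN 0 0
  simp only [add_zero, sub_zero] at h
  linarith

lemma map_neg_of_parallelogram (hN : ∀ x y, N (x + y) + N (x - y) = 2 * N x + 2 * N y) (x : L) :
    N (-x) = N x := by
  have h := hN 0 x
  rw [zero_add, zero_sub, map_zero_of_parallelogram hN] at h
  linarith

lemma map_add_add_of_parallelogram
    (hN : ∀ x y, N (x + y) + N (x - y) = 2 * N x + 2 * N y) (a b c : L) :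
    N (a + b + c) = N (a + b) + N (a + c) + N (b + c) - N a - N b - N c := by
  have h₁ := hN (a + b) c
  have h₂ := hN (a + c) b
  have h₃ := hN a (b - c)
  have h₄ := hN b c
  rw [show a + c + b = a + b + c by abel, show a + c - b = a - (b - c) by abel] at h₂
  rw [show a + (b - c) = a + b - c by abel] at h₃
  linarith

variable {m : ℝ}

/-- Minimal vectors that agree modulo `2L` agree up to sign: otherwise `(v + w) / 2` and
`(v - w) / 2` would be nonzero lattice vectors whose values add up to `m`. -/
lemma eq_or_eq_neg_of_sub_eq_add_self
    (hN : ∀ x y, N (x + y) + N (x - y) = 2 * N x + 2 * N y)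
    (hm : 0 < m) (hmin : ∀ x, x ≠ 0 → m ≤ N x) {v w x : L} (hv : N v = m) (hw : N w = m)
    (hx : v - w = x + x) : v = w ∨ v = -w := by
  by_contra! h
  have hx0 : x ≠ 0 := by
    rintro rfl
    exact h.1 (sub_eq_zero.1 (by simpa using hx))
  have hy0 : w + x ≠ 0 := by
    intro h0
    apply h.2
    rw [eq_add_of_sub_eq hx, eq_neg_iff_add_eq_zero,
      show x + x + w + w = (w + x) + (w + x) by abel, h0, add_zero]
  have hp := hN (w + x) x
  rw [show w + x + x = v by rw [eq_add_of_sub_eq hx]; abel, add_sub_cancel_right] at hp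
  linarith [hmin _ hx0, hmin _ hy0]

/-- If the classes modulo `2L` of three minimal vectors `a`, `b`, `d` add up to zero, then `d` is
one of `± a ± b`: otherwise the four vectors `(a ± b ± d) / 2` would be nonzero, but their values
add up to `3 m`. Consequently one of `a ± b` is minimal. -/
lemma map_add_eq_or_map_sub_eq
    (hN : ∀ x y, N (x + y) + N (x - y) = 2 * N x + 2 * N y)
    (hm : 0 < m) (hmin : ∀ x, x ≠ 0 → m ≤ N x) {a b d x : L}
    (ha : N a = m) (hb : N b = m) (hd : N d = m) (hx : a + b + d = x + x) :
    N (a + b) = m ∨ N (a - b) = m := by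
  have hneg := map_neg_of_parallelogram hN
  have hd' : d = x + x - a - b := by rw [← hx]; abel
  by_cases h₀ : x = 0
  · left
    rw [← hd, hd', h₀, ← hneg]
    congr 1; abel
  by_cases h₁ : x = a
  · right
    rw [← hd, hd', h₁]
    congr 1; abel
  by_cases h₂ : x = b
  · right
    rw [← hd, hd', h₂, ← hneg]
    congr 1; abel
  by_cases h₃ : x = d
  · left
    rw [← hd]
    congr 1
    have : a + b + d = d + d := by rw [hx, h₃]
    exact add_right_cancel this
  exfalso
  have e₁ := hN x (x - d)
  rw [show x + (x - d) = a + b by rw [hd']; abel, sub_sub_cancel] at e₁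
  have e₂ := hN (x - a) (x - b)
  rw [show x - a + (x - b) = d by rw [hd']; abel, show x - a - (x - b) = -(a - b) by abel,
    hneg] at e₂
  have e₃ := hN a b
  linarith [hmin _ h₀, hmin _ (sub_ne_zero.2 h₁), hmin _ (sub_ne_zero.2 h₂),
    hmin _ (sub_ne_zero.2 h₃)]

/-- The seven nonzero elements of a three-dimensional subspace of `L / 2L` are not all classes of
minimal vectors. Up to signs, `a + b` and `a + c` are minimal and `N (b + c)` is `m` or `3 m`. Then
`N (a + b + c)` and `N (a + b - c)` are even multiples of `m`, whereas a minimal vector in the class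
of `a + b + c` makes one of them equal to `m`. -/
lemma not_forall_minimal
    (hN : ∀ x y, N (x + y) + N (x - y) = 2 * N x + 2 * N y)
    (hm : 0 < m) (hmin : ∀ x, x ≠ 0 → m ≤ N x) {V : Type*} [AddCommGroup V] (π : L →+ V)
    (hV : ∀ t : V, t + t = 0) (hker : ∀ v, π v = 0 → ∃ x, v = x + x) {s t u : V}
    (h : ∀ r ∈ ({s, t, u, s + t, s + u, t + u, s + t + u} : Set V), r ∈ π '' {v | N v = m}) :
    False := by
  have hneg := map_neg_of_parallelogram hN
  have hadj {a b : L} (ha : N a = m) (hb : N b = m) (hab : π a + π b ∈ π '' {v | N v = m}) :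
      N (a + b) = m ∨ N (a - b) = m := by
    obtain ⟨d, hd, hπ⟩ := hab
    obtain ⟨x, hx⟩ := hker (a + b + d) (by rw [map_add, map_add, hπ, hV])
    exact map_add_eq_or_map_sub_eq hN hm hmin ha hb hd hx
  have hπneg (v : L) : π (-v) = π v := by
    rw [map_neg, neg_eq_iff_add_eq_zero, hV]
  obtain ⟨a, ha, rfl⟩ := h s (by simp)
  have hsign {r : V} (hr : r ∈ π '' {v | N v = m}) (har : π a + r ∈ π '' {v | N v = m}) :
      ∃ b, N b = m ∧ π b = r ∧ N (a + b) = m := by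
    obtain ⟨b, hb, rfl⟩ := hr
    obtain h | h := hadj ha hb har
    · exact ⟨b, hb, rfl, h⟩
    · exact ⟨-b, by rw [hneg, hb], hπneg b, by rwa [← sub_eq_add_neg]⟩
  obtain ⟨b, hb, rfl, hab⟩ := hsign (h t (by simp)) (h _ (by simp))
  obtain ⟨c, hc, rfl, hac⟩ := hsign (h u (by simp)) (h _ (by simp))
  have hbc := hadj hb hc (h _ (by simp))
  have habc := hadj hab hc (by rw [map_add]; exact h _ (by simp))
  replace ha : N a = m := ha
  have e₁ := map_add_add_of_parallelogram hN a b c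
  have e₂ := hN (a + b) c
  have e₃ := hN b c
  rcases hbc with hbc | hbc <;> rcases habc with habc | habc <;> linarith

end ParallelogramLaw

/-! ### Lattices of rank four -/

/-- In an elementary abelian group of order `16`, a set whose complement consists of zero and at
most two further elements `p`, `q` contains the nonzero elements of a subgroup of order `8`,
spanned by `p + q` and two elements avoiding the subgroups generated so far together with `p`. -/
lemma exists_subspace_of_card_compl_le {V : Type*} [AddCommGroup V] (hV : ∀ t : V, t + t = 0)
    (hcard : Nat.card V = 16) {T : Set V} (h0 : (0 : V) ∉ T) (hT : 12 < T.encard) :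
    ∃ s t u : V, ∀ r ∈ ({s, t, u, s + t, s + u, t + u, s + t + u} : Set V), r ∈ T := by
  classical
  have : Finite V := Nat.finite_of_card_ne_zero (by omega)
  have := Fintype.ofFinite V
  rw [Nat.card_eq_fintype_card] at hcard
  have hM : T.toFinsetᶜ.card ≤ 3 := by
    rw [Set.encard_eq_coe_toFinset_card] at hT
    have : 12 < T.toFinset.card := by exact_mod_cast hT
    rw [Finset.card_compl, hcard]
    omega
  obtain ⟨P, hMP, hP⟩ := Finset.exists_superset_card_eq hM (by omega)
  have h0P : (0 : V) ∈ P := hMP (by simpa using h0)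
  obtain ⟨p, q, hpq, hPpq⟩ := Finset.card_eq_two.1
    (show (P.erase 0).card = 2 by rw [Finset.card_erase_of_mem h0P, hP])
  have hp0 : p ≠ 0 := Finset.ne_of_mem_erase (s := P) (by simp [hPpq])
  have hq0 : q ≠ 0 := Finset.ne_of_mem_erase (s := P) (by simp [hPpq])
  have hmem (r : V) (h₁ : r ≠ 0) (h₂ : r ≠ p) (h₃ : r ≠ q) : r ∈ T := by
    by_contra hr
    have : r ∈ P.erase 0 := Finset.mem_erase.2 ⟨h₁, hMP (by simpa using hr)⟩
    simp [hPpq, h₂, h₃] at this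
  have hex (E : Finset V) (hE : E.card < 16) : ∃ r, r ∉ E := by
    by_contra! h
    rw [Finset.eq_univ_of_forall h, Finset.card_univ, hcard] at hE
    omega
  obtain ⟨b, hb⟩ := hex {0, p, q, p + q} (Finset.card_le_four.trans_lt (by omega))
  obtain ⟨c, hc⟩ := hex ({0, p, q, p + q} ∪ {b, b + p, b + q, b + (p + q)})
    ((Finset.card_union_le _ _).trans_lt
      (by have := Finset.card_le_four (a := (0 : V)) (b := p) (c := q) (d := p + q)
          have := Finset.card_le_four (a := b) (b := b + p) (c := b + q) (d := b + (p + q))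
          omega))
  simp only [Finset.mem_union, Finset.mem_insert, Finset.mem_singleton, not_or] at hb hc
  have hp := hV p
  have hq := hV q
  have hb' := hV b
  have hc' := hV c
  refine ⟨p + q, b, c, ?_⟩
  simp only [Set.mem_insert_iff, Set.mem_singleton_iff, forall_eq_or_imp, forall_eq]
  refine ⟨?_, ?_, ?_, ?_, ?_, ?_, ?_⟩ <;> apply hmem <;> grind

/-- The kissing number bound for lattices of rank four. Pairs of minimal vectors inject into
`L / 2L`, which has `16` elements; if there were more than twelve, their classes would contain the
nonzero part of a three-dimensional subspace. -/
lemma encard_pairs_le {L : Type*} [AddCommGroup L] [Module.Free ℤ L] [Module.Finite ℤ L]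
    (hrank : Module.finrank ℤ L = 4) {N : L → ℝ}
    (hN : ∀ x y, N (x + y) + N (x - y) = 2 * N x + 2 * N y) {m : ℝ}
    (hm : 0 < m) (hmin : ∀ x, x ≠ 0 → m ≤ N x) :
    ((fun v : L => ({v, -v} : Set L)) '' {v | N v = m}).encard ≤ 12 := by
  set S : Set L := {v | N v = m}
  let π : L →+ ModN L 2 := ModN.mkQ 2
  have hker (v : L) (hv : π v = 0) : ∃ x, v = x + x := by
    obtain ⟨x, hx⟩ := (Submodule.Quotient.mk_eq_zero _).1 hv
    exact ⟨x, by rw [← hx]; simp [two_smul]⟩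
  have hV (t : ModN L 2) : t + t = 0 := by
    rw [← two_nsmul]
    exact ZModModule.char_nsmul_eq_zero 2 t
  have hcard : Nat.card (ModN L 2) = 16 := by
    rw [ModN.natCard_eq, hrank]; norm_num
  have h0 : (0 : ModN L 2) ∉ π '' S := by
    rintro ⟨v, hv, hπ⟩
    obtain ⟨x, rfl⟩ := hker v hπ
    have hx0 : x ≠ 0 := by
      rintro rfl
      replace hv : N (0 + 0) = m := hv
      rw [add_zero, map_zero_of_parallelogram hN] at hv
      exact hm.ne hv
    have := hN x x
    rw [sub_self, map_zero_of_parallelogram hN, show N (x + x) = m from hv] at this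
    linarith [hmin x hx0]
  have hle : ((fun v : L => ({v, -v} : Set L)) '' S).encard ≤ (π '' S).encard := by
    choose! g hg using fun (t : ModN L 2) (ht : t ∈ π '' S) => ht
    refine le_trans (Set.encard_le_encard ?_)
      (Set.encard_image_le (fun t => ({g t, -g t} : Set L)) (π '' S))
    rintro _ ⟨v, hv, rfl⟩
    refine ⟨π v, ⟨v, hv, rfl⟩, ?_⟩
    obtain ⟨hgS, hgπ⟩ := hg (π v) ⟨v, hv, rfl⟩
    obtain ⟨x, hx⟩ := hker (g (π v) - v) (by rw [map_sub, hgπ, sub_self])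
    obtain h | h := eq_or_eq_neg_of_sub_eq_add_self hN hm hmin hgS hv hx
    · simp only [h]
    · simp only [h, neg_neg, Set.pair_comm]
  refine hle.trans (not_lt.1 fun hlt => ?_)
  obtain ⟨s, t, u, h⟩ := exists_subspace_of_card_compl_le hV hcard h0 hlt
  exact not_forall_minimal hN hm hmin π hV hker h

/-! ### The upper bound for binary Hermitian forms -/

lemma value_add_add_value_sub (A : Matrix (Fin 2) (Fin 2) ℂ) (x y : Fin 2 → ℂ) :
    value A (x + y) + value A (x - y) = 2 * value A x + 2 * value A y := by
  simp only [value, star_add, star_sub, Matrix.mulVec_add, Matrix.mulVec_sub, add_dotProduct,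
    sub_dotProduct, dotProduct_add, dotProduct_sub, Complex.add_re, Complex.sub_re]
  ring

lemma value_nonneg {A : Matrix (Fin 2) (Fin 2) ℂ} (hA : A.PosDef) (x : Fin 2 → ℂ) :
    0 ≤ value A x :=
  hA.posSemidef.re_dotProduct_nonneg x

lemma value_pos {A : Matrix (Fin 2) (Fin 2) ℂ} (hA : A.PosDef) {x : Fin 2 → ℂ} (hx : x ≠ 0) :
    0 < value A x :=
  hA.re_dotProduct_pos hx

section

variable {F : Type*} [Field F]

lemma embed_add (φ : F →+* ℂ) (v w : Fin 2 → NumberField.RingOfIntegers F) :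
    embed φ (v + w) = embed φ v + embed φ w := by
  ext i; simp [embed]

lemma embed_sub (φ : F →+* ℂ) (v w : Fin 2 → NumberField.RingOfIntegers F) :
    embed φ (v - w) = embed φ v - embed φ w := by
  ext i; simp [embed]

lemma embed_eq_zero (φ : F →+* ℂ) {v : Fin 2 → NumberField.RingOfIntegers F} :
    embed φ v = 0 ↔ v = 0 := by
  simp [embed, funext_iff]

lemma minimum_le (φ : F →+* ℂ) {A : Matrix (Fin 2) (Fin 2) ℂ} (hA : A.PosDef)
    {v : Fin 2 → NumberField.RingOfIntegers F} (hv : v ≠ 0) :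
    minimum φ A ≤ value A (embed φ v) :=
  csInf_le ⟨0, by rintro _ ⟨w, -, rfl⟩; exact value_nonneg hA _⟩ ⟨v, hv, rfl⟩

lemma minimum_nonneg (φ : F →+* ℂ) {A : Matrix (Fin 2) (Fin 2) ℂ} (hA : A.PosDef) :
    0 ≤ minimum φ A :=
  Real.sInf_nonneg (by rintro _ ⟨w, -, rfl⟩; exact value_nonneg hA _)

variable [NumberField F]

lemma encard_minPairs_le (hF : IsImaginaryQuadratic F) (φ : F →+* ℂ)
    {A : Matrix (Fin 2) (Fin 2) ℂ} (hA : A.PosDef) : (minPairs φ A).encard ≤ 12 := by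
  obtain hm | hm := (minimum_nonneg φ hA).eq_or_lt
  · -- If the infimum were zero, the zero vector would be the only candidate.
    have hsub : minVectors φ A ⊆ {0} := by
      intro v hv
      by_contra hv0
      have hpos := value_pos hA (mt (embed_eq_zero φ).1 hv0)
      rw [show value A (embed φ v) = minimum φ A from hv, ← hm] at hpos
      exact hpos.false
    calc (minPairs φ A).encard ≤ (minVectors φ A).encard := Set.encard_image_le _ _
      _ ≤ 1 := (Set.encard_le_encard hsub).trans (Set.encard_singleton _).le
      _ ≤ 12 := by norm_num
  · refine encard_pairs_le (N := fun v => value A (embed φ v)) ?_ (fun v w => ?_) hm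
      fun v hv => minimum_le φ hA hv
    · rw [Module.finrank_pi_fintype]
      simp [NumberField.RingOfIntegers.rank, hF.1]
    · simp only [embed_add, embed_sub, value_add_add_value_sub]

/-- An imaginary quadratic field has a single infinite place, so the squared absolute value of an
algebraic integer is the absolute value of its norm. -/
lemma one_le_normSq (hF : IsImaginaryQuadratic F) (φ : F →+* ℂ)
    {x : NumberField.RingOfIntegers F} (hx : x ≠ 0) : 1 ≤ Complex.normSq (φ x) := by
  have := hF.2
  have hcard : Fintype.card (NumberField.InfinitePlace F) = 1 := by
    have h₁ := NumberField.IsTotallyComplex.finrank F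
    have h₂ := NumberField.InfinitePlace.card_eq_nrRealPlaces_add_nrComplexPlaces F
    rw [NumberField.IsTotallyComplex.nrRealPlaces_eq_zero] at h₂
    rw [hF.1] at h₁
    omega
  have hsub := Fintype.card_le_one_iff.1 hcard.le
  have h := NumberField.InfinitePlace.one_le_of_lt_one (w := .mk φ) hx
    fun z hz => absurd (hsub _ _) hz
  rw [NumberField.InfinitePlace.apply] at h
  rw [Complex.normSq_eq_norm_sq]
  nlinarith

end

/-! ### A Gaussian form attaining the bound -/

/-- The matrix of the form `|(1 - i) x + y|² + |y|²`. As a quadratic form on `ℤ[i]²` it is the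
root lattice `D₄`, which has `24` minimal vectors. -/
noncomputable def formD4 : Matrix (Fin 2) (Fin 2) ℂ :=
  !![2, 1 + Complex.I; 1 - Complex.I, 2]

lemma value_formD4 (x : Fin 2 → ℂ) :
    value formD4 x =
      Complex.normSq ((1 - Complex.I) * x 0 + x 1) + Complex.normSq (x 1) := by
  simp [value, formD4, Matrix.mulVec, dotProduct, Fin.sum_univ_two, Complex.normSq_apply]
  ring

lemma formD4_posDef : formD4.PosDef := by
  have hB : formD4 = (!![1 - Complex.I, 1; 0, 1] : Matrix (Fin 2) (Fin 2) ℂ).conjTranspose *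
      !![1 - Complex.I, 1; 0, 1] := by
    ext i j
    fin_cases i <;> fin_cases j <;>
      simp [formD4, Matrix.mul_apply, Fin.sum_univ_two, Complex.ext_iff] <;> norm_num
  rw [hB]
  refine Matrix.PosDef.conjTranspose_mul_self _ ?_
  rw [Matrix.mulVec_injective_iff_isUnit, Matrix.isUnit_iff_isUnit_det, isUnit_iff_ne_zero]
  simp [Matrix.det_fin_two, Complex.ext_iff]

section

variable {F : Type*} [Field F]

lemma embed_map (φ : F →+* ℂ) (ψ : GaussianInt →+* NumberField.RingOfIntegers F)
    (hψ : ∀ z, φ (ψ z) = GaussianInt.toComplex z) (v : Fin 2 → GaussianInt) (k : Fin 2) :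
    embed φ (fun i => ψ (v i)) k = GaussianInt.toComplex (v k) :=
  hψ _

lemma value_formD4_map {φ : F →+* ℂ} {ψ : GaussianInt →+* NumberField.RingOfIntegers F}
    (hψ : ∀ z, φ (ψ z) = GaussianInt.toComplex z) (v : Fin 2 → GaussianInt) :
    value formD4 (embed φ (fun i => ψ (v i))) =
      ((Zsqrtd.norm ((⟨1, -1⟩ : GaussianInt) * v 0 + v 1) + Zsqrtd.norm (v 1) : ℤ) : ℝ) := by
  rw [value_formD4, embed_map φ ψ hψ, embed_map φ ψ hψ, Int.cast_add,
    GaussianInt.intCast_real_norm, GaussianInt.intCast_real_norm, GaussianInt.toComplex_add,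
    GaussianInt.toComplex_mul]
  simp [GaussianInt.toComplex_def', sub_eq_add_neg]

variable [NumberField F]

/-- Writing `z = (1 - i) x + y`, the value is `|z|² + |y|²`. It is at least `1 + 1` if `z` and `y`
are nonzero, and equals `2 |x|²` if one of them vanishes. -/
lemma two_le_value_formD4 (hF : IsImaginaryQuadratic F) {φ : F →+* ℂ}
    {ψ : GaussianInt →+* NumberField.RingOfIntegers F}
    (hψ : ∀ z, φ (ψ z) = GaussianInt.toComplex z)
    {v : Fin 2 → NumberField.RingOfIntegers F} (hv : v ≠ 0) :
    2 ≤ value formD4 (embed φ v) := by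
  set z := ψ ⟨1, -1⟩ * v 0 + v 1 with hz
  have hφz : φ z = (1 - Complex.I) * φ (v 0) + φ (v 1) := by
    simp [hz, hψ, GaussianInt.toComplex_def', sub_eq_add_neg]
  have hnorm : Complex.normSq (1 - Complex.I) = 2 := by
    simp [Complex.normSq_apply]; norm_num
  have hval : value formD4 (embed φ v) = Complex.normSq (φ z) + Complex.normSq (φ (v 1)) := by
    rw [value_formD4, hφz]; rfl
  rw [hval]
  by_cases h1 : v 1 = 0
  · have h0 : v 0 ≠ 0 := fun h0 => hv (by ext i; fin_cases i <;> simp [h0, h1])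
    rw [hφz]
    simp only [h1, map_zero, add_zero, map_mul, hnorm]
    linarith [one_le_normSq hF φ h0]
  · by_cases hz0 : z = 0
    · have h0 : v 0 ≠ 0 := by
        intro h0
        rw [hz, h0, mul_zero, zero_add] at hz0
        exact h1 hz0
      have hφ0 : φ z = 0 := by simp [hz0]
      rw [hφ0] at hφz ⊢
      rw [map_zero, zero_add, ← neg_eq_of_add_eq_zero_right hφz.symm,
        Complex.normSq_neg, map_mul, hnorm]
      linarith [one_le_normSq hF φ h0]
    · linarith [one_le_normSq hF φ h1, one_le_normSq hF φ hz0]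

lemma minimum_formD4 (hF : IsImaginaryQuadratic F) {φ : F →+* ℂ}
    {ψ : GaussianInt →+* NumberField.RingOfIntegers F}
    (hψ : ∀ z, φ (ψ z) = GaussianInt.toComplex z) : minimum φ formD4 = 2 := by
  refine IsLeast.csInf_eq ⟨⟨fun i => ψ ((![1, 0] : Fin 2 → GaussianInt) i), ?_, ?_⟩, ?_⟩
  · intro h
    simpa using congrFun h 0
  · exact (value_formD4_map hψ _).trans (by norm_num [Zsqrtd.norm_def])
  · rintro _ ⟨v, hv, rfl⟩
    exact two_le_value_formD4 hF hψ hv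

lemma map_mem_minVectors_formD4 (hF : IsImaginaryQuadratic F) {φ : F →+* ℂ}
    {ψ : GaussianInt →+* NumberField.RingOfIntegers F}
    (hψ : ∀ z, φ (ψ z) = GaussianInt.toComplex z) {v : Fin 2 → GaussianInt}
    (hv : Zsqrtd.norm ((⟨1, -1⟩ : GaussianInt) * v 0 + v 1) + Zsqrtd.norm (v 1) = 2) :
    (fun i => ψ (v i)) ∈ minVectors φ formD4 := by
  change value _ _ = _
  rw [value_formD4_map hψ, minimum_formD4 hF hψ, hv]
  norm_num

/-- Representatives, up to sign, of the solutions of `|(1 - i) x + y|² + |y|² = 2` in Gaussian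
integers. -/
def minimalGaussian : Fin 12 → Fin 2 → GaussianInt :=
  ![![⟨1, 0⟩, ⟨0, 0⟩], ![⟨0, 1⟩, ⟨0, 0⟩],
    ![⟨1, 0⟩, ⟨-1, 1⟩], ![⟨0, 1⟩, ⟨-1, -1⟩],
    ![⟨0, 0⟩, ⟨1, 0⟩], ![⟨0, 0⟩, ⟨0, 1⟩],
    ![⟨-1, -1⟩, ⟨1, 0⟩], ![⟨1, -1⟩, ⟨0, 1⟩],
    ![⟨-1, 0⟩, ⟨1, 0⟩], ![⟨0, -1⟩, ⟨0, 1⟩],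
    ![⟨0, -1⟩, ⟨1, 0⟩], ![⟨1, 0⟩, ⟨0, 1⟩]]

lemma norm_minimalGaussian (k : Fin 12) :
    Zsqrtd.norm ((⟨1, -1⟩ : GaussianInt) * minimalGaussian k 0 + minimalGaussian k 1) +
      Zsqrtd.norm (minimalGaussian k 1) = 2 := by
  revert k; decide

lemma minimalGaussian_pairwise (k l : Fin 12)
    (h : minimalGaussian k = minimalGaussian l ∨ minimalGaussian k = -minimalGaussian l) :
    k = l := by
  revert k l; decide

lemma twelve_le_encard_minPairs_formD4 (hF : IsImaginaryQuadratic F) {φ : F →+* ℂ}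
    {ψ : GaussianInt →+* NumberField.RingOfIntegers F}
    (hψ : ∀ z, φ (ψ z) = GaussianInt.toComplex z) : 12 ≤ (minPairs φ formD4).encard := by
  have hinj : Function.Injective ψ := fun z w h => by
    rw [← GaussianInt.toComplex_inj, ← hψ, ← hψ, h]
  let g (k : Fin 12) : Fin 2 → NumberField.RingOfIntegers F := fun i => ψ (minimalGaussian k i)
  have hg : Function.Injective fun k => ({g k, -g k} : Set _) := by
    intro k l h
    have hk : g k ∈ ({g l, -g l} : Set _) := by
      rw [← show ({g k, -g k} : Set _) = {g l, -g l} from h]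
      exact Set.mem_insert _ _
    refine minimalGaussian_pairwise k l (hk.imp (fun h => ?_) fun h => ?_)
    · exact funext fun i => hinj (congrFun h i)
    · exact funext fun i => hinj ((congrFun h i).trans (map_neg ψ _).symm)
  calc (12 : ℕ∞) = (Set.range fun k => ({g k, -g k} : Set _)).encard := by
        rw [← Set.image_univ, hg.encard_image, Set.encard_univ]
        simp
    _ ≤ _ := Set.encard_le_encard (by
        rintro _ ⟨k, rfl⟩
        exact ⟨g k, map_mem_minVectors_formD4 hF hψ (norm_minimalGaussian k), rfl⟩)

lemma isPerfect_formD4 (hF : IsImaginaryQuadratic F) {φ : F →+* ℂ}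
    {ψ : GaussianInt →+* NumberField.RingOfIntegers F}
    (hψ : ∀ z, φ (ψ z) = GaussianInt.toComplex z) : IsPerfect φ formD4 := by
  refine ⟨formD4_posDef, le_antisymm (Submodule.span_le.2 ?_) fun M hM => ?_⟩
  · rintro _ ⟨v, -, rfl⟩
    change IsSelfAdjoint (q φ v)
    rw [IsSelfAdjoint, Matrix.star_eq_conjTranspose, q, Matrix.conjTranspose_vecMulVec, star_star]
  · have hM' : star M = M := hM
    have hmem {v : Fin 2 → GaussianInt} (hv : Zsqrtd.norm ((⟨1, -1⟩ : GaussianInt) * v 0 + v 1) +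
        Zsqrtd.norm (v 1) = 2) :
        Matrix.vecMulVec (fun i => GaussianInt.toComplex (v i))
          (star fun i => GaussianInt.toComplex (v i)) ∈
          Submodule.span ℝ (q φ '' minVectors φ formD4) := by
      refine Submodule.subset_span ⟨_, map_mem_minVectors_formD4 hF hψ hv, ?_⟩
      rw [q, funext (embed_map φ ψ hψ v)]
    have h₁ := hmem (v := ![1, 0]) (by decide)
    have h₂ := hmem (v := ![0, 1]) (by decide)
    have h₃ := hmem (v := ![-1, 1]) (by decide)
    have h₄ := hmem (v := ![1, ⟨0, 1⟩]) (by decide)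
    -- The vectors `(-1, 1)` and `(1, i)` have off-diagonal entries `-1` and `-i`.
    have key := add_mem (add_mem
      (Submodule.smul_mem _ ((M 0 0).re + (M 0 1).re + (M 0 1).im) h₁)
      (Submodule.smul_mem _ ((M 1 1).re + (M 0 1).re + (M 0 1).im) h₂))
      (add_mem (Submodule.smul_mem _ (-(M 0 1).re) h₃) (Submodule.smul_mem _ (-(M 0 1).im) h₄))
    convert key using 1
    have h00 := congrArg Complex.im (congrFun (congrFun hM' 0) 0)
    have h11 := congrArg Complex.im (congrFun (congrFun hM' 1) 1)
    have h10 := congrFun (congrFun hM' 1) 0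
    simp only [Matrix.star_apply] at h00 h11 h10
    simp only [Complex.star_def, Complex.conj_im] at h00 h11
    ext i j
    fin_cases i <;> fin_cases j
    · refine Complex.ext ?_ ?_ <;> simp [Matrix.vecMulVec_apply] <;> linarith
    · simp [Matrix.vecMulVec_apply, GaussianInt.toComplex_def']
    · refine Complex.ext ?_ ?_ <;>
        simp [← h10, Matrix.vecMulVec_apply, GaussianInt.toComplex_def']
    · refine Complex.ext ?_ ?_ <;>
        simp [Matrix.vecMulVec_apply, GaussianInt.toComplex_def'] <;> linarith

end

/-! ### The Gaussian field -/

section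

lemma exists_isCyclotomicExtension_four : ∃ (F : Type) (_ : Field F) (_ : NumberField F),
    IsCyclotomicExtension {4} ℚ F := by
  refine ⟨CyclotomicField 4 ℚ, inferInstance, inferInstance, ?_⟩
  -- The goal uses the `ℚ`-algebra structure of a division ring of characteristic zero.
  rw [Subsingleton.elim DivisionRing.toRatAlgebra (CyclotomicField.algebra 4 ℚ)]
  exact CyclotomicField.isCyclotomicExtension 4 ℚ

variable {F : Type} [Field F] [NumberField F] [IsCyclotomicExtension {4} ℚ F]

variable (F) in
lemma isImaginaryQuadratic_of_isCyclotomicExtension_four : IsImaginaryQuadratic F := by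
  refine ⟨?_, IsCyclotomicExtension.Rat.isTotallyComplex (n := 4) _ (by norm_num)⟩
  rw [IsCyclotomicExtension.finrank (n := 4) _
    (Polynomial.cyclotomic.irreducible_rat (by norm_num))]
  decide

/-- Gaussian integers inside `ℚ(ζ₄)`: some square root of `-1` is sent to `i` by the given complex
embedding. -/
lemma exists_gaussianInt_hom (φ : F →+* ℂ) :
    ∃ ψ : GaussianInt →+* NumberField.RingOfIntegers F,
      ∀ z, φ (ψ z) = GaussianInt.toComplex z := by
  have hζ := IsCyclotomicExtension.zeta_spec 4 ℚ F
  have hr : ∃ r : NumberField.RingOfIntegers F, r * r = -1 := by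
    refine ⟨hζ.toInteger, ?_⟩
    have h2 := (hζ.toInteger_isPrimitiveRoot.pow (a := 2) (b := 2) (by norm_num)
      (by norm_num)).eq_neg_one_of_two_right
    rw [← h2, sq]
  have hI : ∃ r : NumberField.RingOfIntegers F,
      r * r = -1 ∧ φ r = Complex.I := by
    obtain ⟨r, hr⟩ := hr
    have hsq : φ r * φ r = Complex.I * Complex.I := by
      rw [Complex.I_mul_I, ← map_mul, ← map_mul, hr]
      simp
    obtain h | h := mul_self_eq_mul_self_iff.1 hsq
    · exact ⟨r, hr, h⟩
    · exact ⟨-r, by rw [neg_mul_neg, hr], by simp [h]⟩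
  obtain ⟨r, hr, hφ⟩ := hI
  refine ⟨Zsqrtd.lift ⟨r, by rw [hr]; simp⟩, fun z => ?_⟩
  simp [GaussianInt.toComplex_def, hφ]

end

end BinaryHermitian

theorem theorem4p1 :
    (∀ (F : Type*) [Field F] [NumberField F], BinaryHermitian.IsImaginaryQuadratic F →
      ∀ (φ : F →+* ℂ) (A : Matrix (Fin 2) (Fin 2) ℂ), A.PosDef →
        (BinaryHermitian.minPairs φ A).encard ≤ 12) ∧
    (∃ (F : Type) (_ : Field F) (_ : NumberField F), BinaryHermitian.IsImaginaryQuadratic F ∧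
      ∃ (φ : F →+* ℂ) (A : Matrix (Fin 2) (Fin 2) ℂ), BinaryHermitian.IsPerfect φ A ∧
        (∀ i j, A i j ∈ φ.range) ∧ (BinaryHermitian.minPairs φ A).encard = 12) := by
  refine ⟨fun F _ _ hF φ A hA => BinaryHermitian.encard_minPairs_le hF φ hA, ?_⟩
  obtain ⟨F, _, _, _⟩ := BinaryHermitian.exists_isCyclotomicExtension_four
  have hF := BinaryHermitian.isImaginaryQuadratic_of_isCyclotomicExtension_four F
  obtain ⟨φ⟩ : Nonempty (F →+* ℂ) := inferInstance
  obtain ⟨ψ, hψ⟩ := BinaryHermitian.exists_gaussianInt_hom φ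
  refine ⟨F, inferInstance, inferInstance, hF, φ, BinaryHermitian.formD4,
    BinaryHermitian.isPerfect_formD4 hF hψ, fun i j => ?_,
    le_antisymm (BinaryHermitian.encard_minPairs_le hF φ BinaryHermitian.formD4_posDef)
      (BinaryHermitian.twelve_le_encard_minPairs_formD4 hF hψ)⟩
  suffices h : ∃ z : GaussianInt, GaussianInt.toComplex z = BinaryHermitian.formD4 i j by
    obtain ⟨z, hz⟩ := h
    exact ⟨ψ z, (hψ z).trans hz⟩
  fin_cases i <;> fin_cases j
  · exact ⟨2, map_ofNat GaussianInt.toComplex 2⟩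
  · exact ⟨⟨1, 1⟩, by simp [BinaryHermitian.formD4, GaussianInt.toComplex_def']⟩
  · exact ⟨⟨1, -1⟩, by
      simp [BinaryHermitian.formD4, GaussianInt.toComplex_def', sub_eq_add_neg]⟩
  · exact ⟨2, map_ofNat GaussianInt.toComplex 2⟩
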